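/- Fix a field $\mathbb K$. A Hom-Leibniz algebra $(\mathfrak g,\alpha_{\mathfrak g})$ over $\mathbb K$ is a $\mathbb K$-vector space $\mathfrak g$ with a bilinear product $[\cdot,\cdot]$ and a linear map $\alpha_{\mathfrak g}:\mathfrak g\to\mathfrak g$ such that, for all $x,y,z\in\mathfrak g$, $\alpha_{\mathfrak g}([x,y])=[\alpha_{\mathfrak g}(x),\alpha_{\mathfrak g}(y)]$ and $[\alpha_{\mathfrak g}(x),[y,z]]=[[x,y],\alpha_{\mathfrak g}(z)]-[[x,z],\alpha_{\mathfrak g}(y)]$; it is regular if $\alpha_{\mathfrak g}$ is bijective. Its $\alpha$-center is the ideal $Z_\alpha(\mathfrak g)=\{x\in\mathfrak g : [\alpha_{\mathfrak g}^n(x),y]=[y,\alpha_{\mathfrak g}^n(x)]=0 \text{ for all } y\in\mathfrak g,\ n\ge 0\}$, and $(\mathfrak g,\alpha_{\mathfrak g})$ is capable if there is a Hom-Leibniz algebra $(\mathfrak k,\alpha_{\mathfrak k})$ with $(\mathfrak g,\alpha_{\mathfrak g})\cong(\mathfrak k/Z_\alpha(\mathfrak k),\bar\alpha_{\mathfrak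 k})$. The exterior square $\mathfrak g\curlywedge\mathfrak g$ is the quotient $(\mathfrak g*\mathfrak g)/(\mathfrak g\,\square\,\mathfrak g)$. Here $\mathfrak g*\mathfrak g$ is the non-abelian Hom-Leibniz tensor product $\mathfrak m*\mathfrak n$ of two copies $\mathfrak m=\mathfrak n=\mathfrak g$ acting on each other by the product of $\mathfrak g$, that is, the Hom-Leibniz algebra generated by symbols $m*n$ and $n*m$ ($m\in\mathfrak m$, $n\in\mathfrak n$), bilinear in their entries, subject to the following relations for all $m,m'\in\mathfrak m$, $n,n'\in\mathfrak n$ (with $\alpha=\alpha_{\mathfrak g}$; we write $a*_{\mathfrak{mn}}b$ for a symbol with first entry $a\in\mathfrak m$ and second entry $b\in\mathfrak n$, and $a*_{\mathfrak{nm}}b$ for one with $a\in\mathfrak n$, $b\in\mathfrak m$): $$\alpha(m)*_{\mathfrak{mn}}[m',n]=-\alpha(m)*_{\mathfrak{mn}}[n,m'],\qquad \alpha(n)*_{\mathfrak{nm}}[n',m]=-\alpha(n)*_{\mathfrak{nm}}[m,n'],$$ $$\alpha(m)*_{\mathfrak{mn}}[n,n']=[m,n]*_{\mathfrak{mn}}\alpha(n')-[m,n']*_{\mathfrak{mn}}\alpha(n),\qquad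 \alpha(n)*_{\mathfrak{nm}}[m,m']=[n,m]*_{\mathfrak{nm}}\alpha(m')-[n,m']*_{\mathfrak{nm}}\alpha(m),$$ $$[m,m']*_{\mathfrak{mn}}\alpha(n)=[m,n]*_{\mathfrak{nm}}\alpha(m')-\alpha(m)*_{\mathfrak{mn}}[n,m'],\qquad [n,n']*_{\mathfrak{nm}}\alpha(m)=[n,m]*_{\mathfrak{mn}}\alpha(n')-\alpha(n)*_{\mathfrak{nm}}[m,n'],$$ and with product $[a*b,c*d]=[a,b]*_{\mathfrak{mn}}[c,d]=[a,b]*_{\mathfrak{nm}}[c,d]$ for symbols of either type; $\mathfrak g\,\square\,\mathfrak g$ is the span of the elements $x*_{\mathfrak{mn}}y-x*_{\mathfrak{nm}}y$, $x,y\in\mathfrak g$. Write $x\curlywedge y$ for the common image of $x*_{\mathfrak{mn}}y$ and $x*_{\mathfrak{nm}}y$. The exterior center is $Z^{\curlywedge}_\alpha(\mathfrak g)=\{x\in\mathfrak g:\alpha_{\mathfrak g}^n(x)\curlywedge y=y\curlywedge\alpha_{\mathfrak g}^n(x)=0\text{ for all }y\in\mathfrak g,\ n\ge0\}$. **Theorem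 5.10.** Let $(\mathfrak g,\alpha_{\mathfrak g})$ be a finite-dimensional regular Hom-Leibniz algebra with $(\mathfrak g,\alpha_{\mathfrak g})=(\mathfrak g_1\oplus\mathfrak g_2,\alpha_{\mathfrak g_1\oplus\mathfrak g_2})$, a direct sum of Hom-Leibniz algebras (product and endomorphism componentwise). If $(\mathfrak g,\alpha_{\mathfrak g})$ is capable, then $(\mathfrak g_1,\alpha_{\mathfrak g_1})$ and $(\mathfrak g_2,\alpha_{\mathfrak g_2})$ are both capable. Moreover, whether or not $\mathfrak g$ is capable, $Z^{\curlywedge}_\alpha(\mathfrak g_1\oplus\mathfrak g_2)=Z^{\curlywedge}_\alpha(\mathfrak g_1)\oplus Z^{\curlywedge}_\alpha(\mathfrak g_2)$. -/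

import Mathlib

open scoped TensorProduct

universe u v v₁ v₂ w

/-- A (multiplicative) Hom-Leibniz algebra structure over the field `k` on the vector space `V`. -/
@[ext]
structure HomLeibnizAlgebra (k : Type u) [Field k] (V : Type v) [AddCommGroup V] [Module k V] where
  /-- the product `[x, y]` -/
  bracket : V →ₗ[k] V →ₗ[k] V
  /-- the companion endomorphism -/
  alpha : V →ₗ[k] V
  /-- multiplicativity: `α [x, y] = [α x, α y]` -/
  alpha_bracket : ∀ x y, alpha (bracket x y) = bracket (alpha x) (alpha y)
  /-- the Hom-Leibniz identity `[α x, [y, z]] = [[x, y], α z] - [[x, z], α y]` -/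
  hom_leibniz : ∀ x y z, bracket (alpha x) (bracket y z) =
    bracket (bracket x y) (alpha z) - bracket (bracket x z) (alpha y)

namespace HomLeibnizAlgebra

variable {k : Type u} [Field k] {V : Type v} [AddCommGroup V] [Module k V]
  {V₁ : Type v₁} [AddCommGroup V₁] [Module k V₁] {V₂ : Type v₂} [AddCommGroup V₂] [Module k V₂]

/-- A Hom-Leibniz algebra is regular if its companion endomorphism is bijective. -/
def IsRegular (G : HomLeibnizAlgebra k V) : Prop := Function.Bijective G.alpha

/-- Isomorphisms of Hom-Leibniz algebras: linear isomorphisms that preserve the products and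
commute with the companion endomorphisms. -/
structure Iso (G₁ : HomLeibnizAlgebra k V₁) (G₂ : HomLeibnizAlgebra k V₂)
    extends V₁ ≃ₗ[k] V₂ where
  map_bracket : ∀ x y, toLinearEquiv (G₁.bracket x y) =
    G₂.bracket (toLinearEquiv x) (toLinearEquiv y)
  map_alpha : ∀ x, toLinearEquiv (G₁.alpha x) = G₂.alpha (toLinearEquiv x)

/-- The direct sum of two Hom-Leibniz algebras, with componentwise product and endomorphism. -/
def directSum (G₁ : HomLeibnizAlgebra k V₁) (G₂ : HomLeibnizAlgebra k V₂) :
    HomLeibnizAlgebra k (V₁ × V₂) where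
  bracket := LinearMap.mk₂ k (fun x y => (G₁.bracket x.1 y.1, G₂.bracket x.2 y.2))
    (by intros; simp) (by intros; simp) (by intros; simp) (by intros; simp)
  alpha := G₁.alpha.prodMap G₂.alpha
  alpha_bracket x y := by simp [G₁.alpha_bracket, G₂.alpha_bracket]
  hom_leibniz x y z := by simp [G₁.hom_leibniz, G₂.hom_leibniz]

/-- Two-sided ideals, invariant under the companion endomorphism. -/
structure IsIdeal (G : HomLeibnizAlgebra k V) (I : Submodule k V) : Prop where
  alpha_mem : ∀ x ∈ I, G.alpha x ∈ I
  bracket_mem_left : ∀ x ∈ I, ∀ y, G.bracket x y ∈ I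
  bracket_mem_right : ∀ x ∈ I, ∀ y, G.bracket y x ∈ I

/-- The quotient of a Hom-Leibniz algebra by an ideal:
`[x + I, y + I] = [x, y] + I` and `α (x + I) = α x + I`. -/
def quotient (G : HomLeibnizAlgebra k V) (I : Submodule k V) (hI : G.IsIdeal I) :
    HomLeibnizAlgebra k (V ⧸ I) where
  bracket := I.liftQ
    (LinearMap.mk₂ k
      (fun (x : V) (y : V ⧸ I) => I.mapQ I (G.bracket x) (fun y hy => hI.bracket_mem_right y hy x) y)
      (by intro x x' y; induction y using Submodule.Quotient.induction_on; simp)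
      (by intro c x y; induction y using Submodule.Quotient.induction_on; simp)
      (by intros; simp) (by intros; simp))
    (by
      intro x hx
      rw [LinearMap.mem_ker]
      ext y
      simpa [Submodule.Quotient.mk_eq_zero] using hI.bracket_mem_left x hx y)
  alpha := I.mapQ I G.alpha hI.alpha_mem
  alpha_bracket x y := by
    induction x using Submodule.Quotient.induction_on
    induction y using Submodule.Quotient.induction_on
    simp [G.alpha_bracket]
  hom_leibniz x y z := by
    induction x using Submodule.Quotient.induction_on
    induction y using Submodule.Quotient.induction_on
    induction z using Submodule.Quotient.induction_on
    simp [G.hom_leibniz]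

/-- The `α`-center: the `x` such that `[αⁿ x, y] = 0 = [y, αⁿ x]` for all `y` and all `n ≥ 0`. -/
def alphaCenter (G : HomLeibnizAlgebra k V) : Submodule k V where
  carrier := {x | ∀ (n : ℕ) (y : V),
    G.bracket ((G.alpha ^ n) x) y = 0 ∧ G.bracket y ((G.alpha ^ n) x) = 0}
  zero_mem' := by intro n y; simp
  add_mem' := by
    intro a b ha hb n y
    simp [ha n y, hb n y]
  smul_mem' := by
    intro c a ha n y
    simp [ha n y]

theorem alphaCenter_isIdeal (G : HomLeibnizAlgebra k V) : G.IsIdeal G.alphaCenter where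
  alpha_mem x hx n y := by
    have h := hx (n + 1) y
    rwa [pow_succ, Module.End.mul_apply] at h
  bracket_mem_left x hx y := by
    rw [show G.bracket x y = 0 from (hx 0 y).1]
    exact Submodule.zero_mem _
  bracket_mem_right x hx y := by
    rw [show G.bracket y x = 0 from (hx 0 y).2]
    exact Submodule.zero_mem _

/-- `G` is capable if it is isomorphic to `K / Z_α(K)` for some Hom-Leibniz algebra `K`.
The universe `w` in which `K` lives is a parameter. -/
def IsCapable (G : HomLeibnizAlgebra k V) : Prop :=
  ∃ (W : Type w) (_ : AddCommGroup W) (_ : Module k W) (K : HomLeibnizAlgebra k W),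
    Nonempty (G.Iso (K.quotient K.alphaCenter K.alphaCenter_isIdeal))

section TensorSquare

/-! The non-abelian tensor product of `G` with itself (two copies `M = N = G`, acting on each other
by the product of `G`) has two families of generating symbols, `m ∗ n` and `n ∗ m`. -/

/-- The symbol `m ∗ n`, with its first entry in the first copy of `G`; bilinear in `(m, n)`. -/
def symMN (m n : V) : (V ⊗[k] V) × (V ⊗[k] V) := (m ⊗ₜ[k] n, 0)

/-- The symbol `n ∗ m`, with its first entry in the second copy of `G`; bilinear in `(n, m)`. -/
def symNM (n m : V) : (V ⊗[k] V) × (V ⊗[k] V) := (0, n ⊗ₜ[k] m)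

/-- The defining relations of the tensor product, beyond bilinearity: `TensorRel G a b` says that
`a = b` is one of them. The last one expresses that the two formulas for the product of two symbols
agree, so that the product is well defined. -/
inductive TensorRel (G : HomLeibnizAlgebra k V) :
    (V ⊗[k] V) × (V ⊗[k] V) → (V ⊗[k] V) × (V ⊗[k] V) → Prop
  | r3a (m m' n : V) : TensorRel G
      (symMN (G.alpha m) (G.bracket m' n)) (-symMN (G.alpha m) (G.bracket n m'))
  | r3b (n n' m : V) : TensorRel G
      (symNM (G.alpha n) (G.bracket n' m)) (-symNM (G.alpha n) (G.bracket m n'))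
  | r4a (m n n' : V) : TensorRel G
      (symMN (G.alpha m) (G.bracket n n'))
      (symMN (G.bracket m n) (G.alpha n') - symMN (G.bracket m n') (G.alpha n))
  | r4b (n m m' : V) : TensorRel G
      (symNM (G.alpha n) (G.bracket m m'))
      (symNM (G.bracket n m) (G.alpha m') - symNM (G.bracket n m') (G.alpha m))
  | r4c (m m' n : V) : TensorRel G
      (symMN (G.bracket m m') (G.alpha n))
      (symNM (G.bracket m n) (G.alpha m') - symMN (G.alpha m) (G.bracket n m'))
  | r4d (n n' m : V) : TensorRel G
      (symNM (G.bracket n n') (G.alpha m))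
      (symMN (G.bracket n m) (G.alpha n') - symNM (G.alpha n) (G.bracket m n'))
  | r5 (a b c d : V) : TensorRel G
      (symMN (G.bracket a b) (G.bracket c d)) (symNM (G.bracket a b) (G.bracket c d))

/-- The span of the defining relations. -/
def tensorRelations (G : HomLeibnizAlgebra k V) : Submodule k ((V ⊗[k] V) × (V ⊗[k] V)) :=
  Submodule.span k {t | ∃ a b, TensorRel G a b ∧ t = a - b}

/-- The underlying space of the non-abelian tensor square `G ∗ G`. -/
abbrev TensorSquare (G : HomLeibnizAlgebra k V) : Type v :=
  ((V ⊗[k] V) × (V ⊗[k] V)) ⧸ G.tensorRelations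

/-- The commutator map on symbols, `m ∗ n ↦ [m, n]` and `n ∗ m ↦ [n, m]`. -/
def preCommutator (G : HomLeibnizAlgebra k V) : (V ⊗[k] V) × (V ⊗[k] V) →ₗ[k] V :=
  (TensorProduct.lift G.bracket).coprod (TensorProduct.lift G.bracket)

/-- The endomorphism of `G ∗ G` on symbols, `m ∗ n ↦ α m ∗ α n` and `n ∗ m ↦ α n ∗ α m`. -/
def preAlpha (G : HomLeibnizAlgebra k V) :
    (V ⊗[k] V) × (V ⊗[k] V) →ₗ[k] (V ⊗[k] V) × (V ⊗[k] V) :=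
  (TensorProduct.map G.alpha G.alpha).prodMap (TensorProduct.map G.alpha G.alpha)

theorem preCommutator_symMN (G : HomLeibnizAlgebra k V) (m n : V) :
    G.preCommutator (symMN m n) = G.bracket m n := by
  simp [preCommutator, symMN]

theorem preCommutator_symNM (G : HomLeibnizAlgebra k V) (m n : V) :
    G.preCommutator (symNM m n) = G.bracket m n := by
  simp [preCommutator, symNM]

theorem preAlpha_symMN (G : HomLeibnizAlgebra k V) (m n : V) :
    G.preAlpha (symMN m n) = symMN (G.alpha m) (G.alpha n) := by
  simp [preAlpha, symMN]

theorem preAlpha_symNM (G : HomLeibnizAlgebra k V) (m n : V) :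
    G.preAlpha (symNM m n) = symNM (G.alpha m) (G.alpha n) := by
  simp [preAlpha, symNM]

theorem preCommutator_eq (G : HomLeibnizAlgebra k V) {a b : (V ⊗[k] V) × (V ⊗[k] V)}
    (h : TensorRel G a b) : G.preCommutator a = G.preCommutator b := by
  cases h <;> simp only [map_neg, map_sub, preCommutator_symMN, preCommutator_symNM,
    G.hom_leibniz] <;> abel

theorem tensorRel_preAlpha (G : HomLeibnizAlgebra k V) {a b : (V ⊗[k] V) × (V ⊗[k] V)}
    (h : TensorRel G a b) : TensorRel G (G.preAlpha a) (G.preAlpha b) := by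
  cases h <;> simp only [map_neg, map_sub, preAlpha_symMN, preAlpha_symNM, G.alpha_bracket] <;>
    constructor

theorem tensorRelations_le_ker (G : HomLeibnizAlgebra k V) :
    G.tensorRelations ≤ LinearMap.ker G.preCommutator := by
  refine Submodule.span_le.2 ?_
  rintro _ ⟨a, b, h, rfl⟩
  simp [G.preCommutator_eq h]

theorem tensorRelations_le_comap (G : HomLeibnizAlgebra k V) :
    G.tensorRelations ≤ G.tensorRelations.comap G.preAlpha := by
  refine Submodule.span_le.2 ?_
  rintro _ ⟨a, b, h, rfl⟩
  exact Submodule.subset_span ⟨_, _, G.tensorRel_preAlpha h, map_sub _ _ _⟩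

/-- The commutator map `G ∗ G → G`. -/
def commutator (G : HomLeibnizAlgebra k V) : G.TensorSquare →ₗ[k] V :=
  G.tensorRelations.liftQ G.preCommutator G.tensorRelations_le_ker

/-- The generator `m ∗ n` of `G ∗ G`, as a bilinear map. -/
def tmulMN (G : HomLeibnizAlgebra k V) : V →ₗ[k] V →ₗ[k] G.TensorSquare :=
  (TensorProduct.mk k V V).compr₂ (G.tensorRelations.mkQ ∘ₗ LinearMap.inl k _ _)

/-- The generator `n ∗ m` of `G ∗ G`, as a bilinear map. -/
def tmulNM (G : HomLeibnizAlgebra k V) : V →ₗ[k] V →ₗ[k] G.TensorSquare :=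
  (TensorProduct.mk k V V).compr₂ (G.tensorRelations.mkQ ∘ₗ LinearMap.inr k _ _)

theorem tmulMN_eq (G : HomLeibnizAlgebra k V) (m n : V) :
    G.tmulMN m n = G.tensorRelations.mkQ (symMN m n) := rfl

theorem tmulNM_eq (G : HomLeibnizAlgebra k V) (m n : V) :
    G.tmulNM m n = G.tensorRelations.mkQ (symNM m n) := rfl

theorem mkQ_eq (G : HomLeibnizAlgebra k V) {a b : (V ⊗[k] V) × (V ⊗[k] V)}
    (h : TensorRel G a b) : G.tensorRelations.mkQ a = G.tensorRelations.mkQ b := by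
  rw [← sub_eq_zero, ← map_sub]
  exact (Submodule.Quotient.mk_eq_zero _).2 (Submodule.subset_span ⟨a, b, h, rfl⟩)

theorem commutator_tmulMN (G : HomLeibnizAlgebra k V) (m n : V) :
    G.commutator (G.tmulMN m n) = G.bracket m n := G.preCommutator_symMN m n

theorem commutator_tmulNM (G : HomLeibnizAlgebra k V) (m n : V) :
    G.commutator (G.tmulNM m n) = G.bracket m n := G.preCommutator_symNM m n

/-- The endomorphism of `G ∗ G`. -/
def tensorAlpha (G : HomLeibnizAlgebra k V) : G.TensorSquare →ₗ[k] G.TensorSquare :=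
  G.tensorRelations.mapQ G.tensorRelations G.preAlpha G.tensorRelations_le_comap

theorem tensorAlpha_tmulMN (G : HomLeibnizAlgebra k V) (m n : V) :
    G.tensorAlpha (G.tmulMN m n) = G.tmulMN (G.alpha m) (G.alpha n) := by
  simp only [tmulMN_eq, ← preAlpha_symMN]; rfl

theorem tensorAlpha_tmulNM (G : HomLeibnizAlgebra k V) (m n : V) :
    G.tensorAlpha (G.tmulNM m n) = G.tmulNM (G.alpha m) (G.alpha n) := by
  simp only [tmulNM_eq, ← preAlpha_symNM]; rfl

theorem tensorSquare_hom_ext (G : HomLeibnizAlgebra k V) {W : Type w} [AddCommGroup W] [Module k W]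
    {f g : G.TensorSquare →ₗ[k] W} (h₁ : ∀ m n, f (G.tmulMN m n) = g (G.tmulMN m n))
    (h₂ : ∀ m n, f (G.tmulNM m n) = g (G.tmulNM m n)) : f = g := by
  apply Submodule.linearMap_qext
  apply LinearMap.prod_ext
  · exact TensorProduct.ext' h₁
  · exact TensorProduct.ext' h₂

theorem commutator_tensorAlpha (G : HomLeibnizAlgebra k V) (t : G.TensorSquare) :
    G.commutator (G.tensorAlpha t) = G.alpha (G.commutator t) := by
  have : G.commutator ∘ₗ G.tensorAlpha = G.alpha ∘ₗ G.commutator := by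
    apply G.tensorSquare_hom_ext
    · intro m n
      simp [tensorAlpha_tmulMN, commutator_tmulMN, G.alpha_bracket]
    · intro m n
      simp [tensorAlpha_tmulNM, commutator_tmulNM, G.alpha_bracket]
  exact LinearMap.congr_fun this t

/-- The non-abelian tensor square `G ∗ G` as a Hom-Leibniz algebra. On symbols the product is
`[a ∗ b, c ∗ d] = [a, b] ∗ [c, d]`, for all four combinations of the two kinds of symbols. -/
def tensorSquare (G : HomLeibnizAlgebra k V) : HomLeibnizAlgebra k G.TensorSquare where
  bracket := G.tmulMN.compl₁₂ G.commutator G.commutator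
  alpha := G.tensorAlpha
  alpha_bracket s t := by
    simp [tensorAlpha_tmulMN, commutator_tensorAlpha]
  hom_leibniz s t r := by
    simp only [LinearMap.compl₁₂_apply, commutator_tensorAlpha, commutator_tmulMN]
    simp only [tmulMN_eq, ← map_sub]
    exact G.mkQ_eq (TensorRel.r4a _ _ _)

/-- The subspace `G □ G` of `G ∗ G`: the span of the `m ∗ n' - n ∗ m'` with `m = n` in `G` and
`m' = n'` in `G`. -/
def box (G : HomLeibnizAlgebra k V) : Submodule k G.TensorSquare :=
  Submodule.span k {t | ∃ m m' : V, t = G.tmulMN m m' - G.tmulNM m m'}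

theorem commutator_box (G : HomLeibnizAlgebra k V) {t : G.TensorSquare} (ht : t ∈ G.box) :
    G.commutator t = 0 := by
  have : G.box ≤ LinearMap.ker G.commutator := by
    refine Submodule.span_le.2 ?_
    rintro _ ⟨m, m', rfl⟩
    simp [commutator_tmulMN, commutator_tmulNM]
  exact this ht

theorem box_isIdeal (G : HomLeibnizAlgebra k V) : G.tensorSquare.IsIdeal G.box where
  alpha_mem := by
    have : G.box ≤ G.box.comap G.tensorAlpha := by
      refine Submodule.span_le.2 ?_
      rintro _ ⟨m, m', rfl⟩
      refine Submodule.subset_span ⟨G.alpha m, G.alpha m', ?_⟩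
      rw [map_sub, tensorAlpha_tmulMN, tensorAlpha_tmulNM]
    exact this
  bracket_mem_left t ht s := by simp [tensorSquare, G.commutator_box ht]
  bracket_mem_right t ht s := by simp [tensorSquare, G.commutator_box ht]

/-- The non-abelian exterior square `G ⋏ G = (G ∗ G) / (G □ G)`. -/
def exteriorSquare (G : HomLeibnizAlgebra k V) : HomLeibnizAlgebra k (G.TensorSquare ⧸ G.box) :=
  G.tensorSquare.quotient G.box G.box_isIdeal

/-- The element `x ⋏ y` of `G ⋏ G`, the common image of the symbols `x ∗ y` of both kinds. -/
def wedge (G : HomLeibnizAlgebra k V) : V →ₗ[k] V →ₗ[k] (G.TensorSquare ⧸ G.box) :=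
  G.tmulMN.compr₂ G.box.mkQ

theorem wedge_eq (G : HomLeibnizAlgebra k V) (x y : V) :
    G.wedge x y = G.box.mkQ (G.tmulNM x y) := by
  rw [← sub_eq_zero]
  change G.box.mkQ (G.tmulMN x y) - G.box.mkQ (G.tmulNM x y) = 0
  rw [← map_sub]
  exact (Submodule.Quotient.mk_eq_zero _).2 (Submodule.subset_span ⟨x, y, rfl⟩)

end TensorSquare

/-- The exterior center: the `x` such that `αⁿ x ⋏ y = 0 = y ⋏ αⁿ x` for all `y` and `n ≥ 0`. -/
def exteriorCenter (G : HomLeibnizAlgebra k V) : Submodule k V where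
  carrier := {x | ∀ (n : ℕ) (y : V),
    G.wedge ((G.alpha ^ n) x) y = 0 ∧ G.wedge y ((G.alpha ^ n) x) = 0}
  zero_mem' := by intro n y; simp
  add_mem' := by
    intro a b ha hb n y
    simp [ha n y, hb n y]
  smul_mem' := by
    intro c a ha n y
    simp [ha n y]

end HomLeibnizAlgebra

/-!
The relations defining `G ⋏ G` collapse to a single one: `x ⋏ y` is the universal bilinear map `b`
with `b (α x) [y, z] = b [x, y] (α z) - b [x, z] (α y)`. Such maps are called `2`-cocycles below,
and the universal property is `exists_wedge_lift`; everything else follows from it by choosing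
cocycles.

*Exterior centers.* Pushing `⋏` along a surjective homomorphism shows that the exterior center is
functorial, so the exterior center of `G₁ ⊕ G₂` projects into those of `G₁` and `G₂`. For the
converse only the mixed products `x₁ ⋏ y₂` matter. The cocycle relation gives
`[G₁, G₁] ⋏ α G₂ = 0 = α G₂ ⋏ [G₁, G₁]`, where `α G₂ = G₂` by regularity. On the other hand
`V ⊗ V → V/[V, V] ⊗ V/[V, V]` is a cocycle, and `x̄ ⊗ x̄ = 0` forces `x̄ = 0` over a field, so the
exterior center lies in the derived subspace (`exteriorCenter_le_derived`). Hence the mixed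
products vanish on the exterior centers.

*Capability.* If `G ≅ K / Z_α(K)`, then the bracket of `K` descends to a cocycle on `G`, and therefore
the exterior center of `G` vanishes. Conversely, the extension of `G` by `G ⋏ G` along the cocycle
`⋏` has `α`-center `Z^⋏(G) ⊕ (G ⋏ G)`, and so `G` is capable as soon as `Z^⋏(G) = 0`. Thus
capability passes to the summands through the formula for the exterior centers. As the algebra `K`
is to live in a prescribed universe, `G₁` and `G₂` are first replaced by isomorphic copies there;
they are small because they are images of the algebra witnessing the capability of `G`.
-/

namespace HomLeibnizAlgebra

section Wedge

variable {k : Type u} [Field k] {V : Type v} [AddCommGroup V] [Module k V]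
  {W : Type w} [AddCommGroup W] [Module k W]

/-! ### The universal property of the exterior square -/

/-- A bilinear map `b` is a `2`-cocycle of `G` if it satisfies the Hom-Leibniz identity with its
outer bracket replaced by `b`. -/
def IsCocycle (G : HomLeibnizAlgebra k V) (b : V →ₗ[k] V →ₗ[k] W) : Prop :=
  ∀ x y z, b (G.alpha x) (G.bracket y z) =
    b (G.bracket x y) (G.alpha z) - b (G.bracket x z) (G.alpha y)

theorem isCocycle_bracket (G : HomLeibnizAlgebra k V) : G.IsCocycle G.bracket := G.hom_leibniz

theorem isCocycle_wedge (G : HomLeibnizAlgebra k V) : G.IsCocycle G.wedge := by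
  intro x y z
  have h := congrArg G.box.mkQ (G.mkQ_eq (TensorRel.r4a x y z))
  simp only [map_sub] at h
  exact h

theorem exists_wedge_lift (G : HomLeibnizAlgebra k V) {b : V →ₗ[k] V →ₗ[k] W}
    (hb : G.IsCocycle b) :
    ∃ F : (G.TensorSquare ⧸ G.box) →ₗ[k] W, ∀ x y, F (G.wedge x y) = b x y := by
  let P : (V ⊗[k] V) × (V ⊗[k] V) →ₗ[k] W := (TensorProduct.lift b).coprod (TensorProduct.lift b)
  have hMN (x y : V) : P (symMN x y) = b x y := by simp [P, symMN]
  have hNM (x y : V) : P (symNM x y) = b x y := by simp [P, symNM]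
  have h₁ : G.tensorRelations ≤ LinearMap.ker P := by
    refine Submodule.span_le.2 ?_
    rintro _ ⟨s, t, h, rfl⟩
    rw [SetLike.mem_coe, LinearMap.mem_ker, map_sub, sub_eq_zero]
    cases h <;> simp only [map_neg, map_sub, hMN, hNM, hb _ _ _] <;> abel
  have h₂ : G.box ≤ LinearMap.ker (G.tensorRelations.liftQ P h₁) := by
    refine Submodule.span_le.2 ?_
    rintro _ ⟨x, y, rfl⟩
    rw [SetLike.mem_coe, LinearMap.mem_ker, map_sub, sub_eq_zero]
    exact (hMN x y).trans (hNM x y).symm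
  exact ⟨G.box.liftQ _ h₂, hMN⟩

theorem IsCocycle.eq_zero_of_wedge_eq_zero {G : HomLeibnizAlgebra k V} {b : V →ₗ[k] V →ₗ[k] W}
    (hb : G.IsCocycle b) {x y : V} (h : G.wedge x y = 0) : b x y = 0 := by
  obtain ⟨F, hF⟩ := G.exists_wedge_lift hb
  rw [← hF, h, map_zero]

theorem exteriorSquare_alpha_wedge (G : HomLeibnizAlgebra k V) (x y : V) :
    G.exteriorSquare.alpha (G.wedge x y) = G.wedge (G.alpha x) (G.alpha y) :=
  congrArg G.box.mkQ (G.tensorAlpha_tmulMN x y)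

/-! ### Functoriality of the exterior center -/

theorem map_alpha_pow {G : HomLeibnizAlgebra k V} {H : HomLeibnizAlgebra k W} {f : V →ₗ[k] W}
    (hα : ∀ x, f (G.alpha x) = H.alpha (f x)) (n : ℕ) (x : V) :
    f ((G.alpha ^ n) x) = (H.alpha ^ n) (f x) := by
  induction n generalizing x with
  | zero => rfl
  | succ n ih => rw [pow_succ, pow_succ, Module.End.mul_apply, Module.End.mul_apply, ih, hα]

theorem map_wedge_eq_zero {G : HomLeibnizAlgebra k V} {H : HomLeibnizAlgebra k W} {f : V →ₗ[k] W}
    (hb : ∀ x y, f (G.bracket x y) = H.bracket (f x) (f y))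
    (hα : ∀ x, f (G.alpha x) = H.alpha (f x)) {x y : V} (h : G.wedge x y = 0) :
    H.wedge (f x) (f y) = 0 := by
  have hc : G.IsCocycle (H.wedge.compl₁₂ f f) := by
    intro x y z
    simpa only [LinearMap.compl₁₂_apply, hb, hα] using H.isCocycle_wedge (f x) (f y) (f z)
  exact hc.eq_zero_of_wedge_eq_zero h

theorem map_mem_exteriorCenter {G : HomLeibnizAlgebra k V} {H : HomLeibnizAlgebra k W}
    {f : V →ₗ[k] W} (hb : ∀ x y, f (G.bracket x y) = H.bracket (f x) (f y))
    (hα : ∀ x, f (G.alpha x) = H.alpha (f x)) (hf : Function.Surjective f) {x : V}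
    (hx : x ∈ G.exteriorCenter) : f x ∈ H.exteriorCenter := by
  intro n y
  obtain ⟨y, rfl⟩ := hf y
  rw [← map_alpha_pow hα]
  exact ⟨map_wedge_eq_zero hb hα (hx n y).1, map_wedge_eq_zero hb hα (hx n y).2⟩

/-- The inverse of an isomorphism of Hom-Leibniz algebras. -/
def Iso.symm {G : HomLeibnizAlgebra k V} {H : HomLeibnizAlgebra k W} (e : G.Iso H) : H.Iso G where
  toLinearEquiv := e.toLinearEquiv.symm
  map_bracket x y := by
    rw [LinearEquiv.symm_apply_eq, e.map_bracket, LinearEquiv.apply_symm_apply,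
      LinearEquiv.apply_symm_apply]
  map_alpha x := by
    rw [LinearEquiv.symm_apply_eq, e.map_alpha, LinearEquiv.apply_symm_apply]

theorem Iso.apply_mem_exteriorCenter {G : HomLeibnizAlgebra k V} {H : HomLeibnizAlgebra k W}
    (e : G.Iso H) {x : V} (hx : x ∈ G.exteriorCenter) : e.toLinearEquiv x ∈ H.exteriorCenter :=
  map_mem_exteriorCenter (f := e.toLinearEquiv.toLinearMap) e.map_bracket e.map_alpha
    e.toLinearEquiv.surjective hx

theorem Iso.map_exteriorCenter {G : HomLeibnizAlgebra k V} {H : HomLeibnizAlgebra k W}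
    (e : G.Iso H) :
    G.exteriorCenter.map (e.toLinearEquiv : V →ₗ[k] W) = H.exteriorCenter := by
  refine le_antisymm ?_ fun y hy => ?_
  · rintro _ ⟨x, hx, rfl⟩
    exact e.apply_mem_exteriorCenter hx
  · exact ⟨_, e.symm.apply_mem_exteriorCenter hy, e.toLinearEquiv.apply_symm_apply y⟩

/-! ### The exterior center lies in the derived subspace -/

/-- The derived subspace `[V, V]`, spanned by all products. -/
def derived (G : HomLeibnizAlgebra k V) : Submodule k V :=
  Submodule.span k {z | ∃ x y, z = G.bracket x y}

theorem bracket_mem_derived (G : HomLeibnizAlgebra k V) (x y : V) : G.bracket x y ∈ G.derived :=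
  Submodule.subset_span ⟨x, y, rfl⟩

/-- The map to the tensor square of the abelianization is a cocycle, since it kills all products
in either entry; and a vector `v` over a field with `v ⊗ v = 0` is zero. -/
theorem exteriorCenter_le_derived (G : HomLeibnizAlgebra k V) : G.exteriorCenter ≤ G.derived := by
  intro x hx
  have hc : G.IsCocycle
      ((TensorProduct.mk k (V ⧸ G.derived) (V ⧸ G.derived)).compl₁₂
        G.derived.mkQ G.derived.mkQ) := by
    have h0 (y z : V) : G.derived.mkQ (G.bracket y z) = 0 :=
      (Submodule.Quotient.mk_eq_zero _).2 (G.bracket_mem_derived y z)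
    intro x y z
    simp [-Submodule.mkQ_apply, LinearMap.compl₁₂_apply, h0]
  have h : G.derived.mkQ x ⊗ₜ[k] G.derived.mkQ x = 0 :=
    hc.eq_zero_of_wedge_eq_zero (by simpa using (hx 0 x).1)
  refine (Submodule.Quotient.mk_eq_zero _).1 (?_ : G.derived.mkQ x = 0)
  refine (Module.forall_dual_apply_eq_zero_iff k _).1 fun φ => mul_self_eq_zero.1 ?_
  simpa using congrArg (TensorProduct.lift ((LinearMap.mul k k).compl₁₂ φ φ)) h

/-! ### Capability and the exterior center -/

/-- The bracket of a Hom-Leibniz algebra `K` with `K / Z_α(K) ≅ G` descends to a cocycle on `G`,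
whose radical is trivial. -/
theorem exteriorCenter_eq_bot_of_isCapable {G : HomLeibnizAlgebra k V}
    (hG : IsCapable.{u, v, w} G) : G.exteriorCenter = ⊥ := by
  obtain ⟨W, _, _, K, ⟨e⟩⟩ := hG
  obtain ⟨s, hs⟩ := K.alphaCenter.mkQ.exists_rightInverse_of_surjective
    (LinearMap.range_eq_top.2 K.alphaCenter.mkQ_surjective)
  replace hs (q) : K.alphaCenter.mkQ (s q) = q := LinearMap.congr_fun hs q
  have congr {a a' b b' : W} (ha : K.alphaCenter.mkQ a = K.alphaCenter.mkQ a')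
      (hb : K.alphaCenter.mkQ b = K.alphaCenter.mkQ b') : K.bracket a b = K.bracket a' b' := by
    have h₁ := ((Submodule.Quotient.eq _).1 ha 0 b).1
    have h₂ := ((Submodule.Quotient.eq _).1 hb 0 a').2
    simp only [pow_zero, Module.End.one_apply, map_sub, LinearMap.sub_apply, sub_eq_zero] at h₁ h₂
    exact h₁.trans h₂
  -- a linear section of `K → G`
  let t : V →ₗ[k] W := s ∘ₗ e.toLinearEquiv.toLinearMap
  have ht (x : V) : K.alphaCenter.mkQ (t x) = e.toLinearEquiv x := hs _
  have htb (x y : V) :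
      K.alphaCenter.mkQ (t (G.bracket x y)) = K.alphaCenter.mkQ (K.bracket (t x) (t y)) := by
    rw [ht, e.map_bracket, ← ht, ← ht]; rfl
  have hta (x : V) : K.alphaCenter.mkQ (t (G.alpha x)) = K.alphaCenter.mkQ (K.alpha (t x)) := by
    rw [ht, e.map_alpha, ← ht]; rfl
  have htn (n : ℕ) (x : V) :
      K.alphaCenter.mkQ (t ((G.alpha ^ n) x)) = K.alphaCenter.mkQ ((K.alpha ^ n) (t x)) := by
    have h := map_alpha_pow (f := e.toLinearEquiv.toLinearMap) e.map_alpha n x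
    have h' := map_alpha_pow (G := K) (H := K.quotient _ K.alphaCenter_isIdeal)
      (f := K.alphaCenter.mkQ) (fun _ => rfl) n (t x)
    rw [h', ht, ht]
    exact h
  have hc : G.IsCocycle (K.bracket.compl₁₂ t t) := by
    intro x y z
    simp only [LinearMap.compl₁₂_apply]
    rw [congr (hta x) (htb y z), congr (htb x y) (hta z), congr (htb x z) (hta y), K.hom_leibniz]
  refine (Submodule.eq_bot_iff _).2 fun x hx => ?_
  have hmem : t x ∈ K.alphaCenter := by
    intro n y
    -- every `y` in `K` agrees with a value of `t` modulo the center
    have hy : K.alphaCenter.mkQ y =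
        K.alphaCenter.mkQ (t (e.toLinearEquiv.symm (K.alphaCenter.mkQ y))) := by
      rw [ht, LinearEquiv.apply_symm_apply]
    rw [congr (htn n x).symm hy, congr hy (htn n x).symm]
    exact ⟨hc.eq_zero_of_wedge_eq_zero (hx n _).1, hc.eq_zero_of_wedge_eq_zero (hx n _).2⟩
  rw [← e.toLinearEquiv.map_eq_zero_iff, ← ht]
  exact (Submodule.Quotient.mk_eq_zero _).2 hmem

/-- The extension of `G` by `G ⋏ G` along the universal cocycle:
`[(x, a), (y, b)] = ([x, y], x ⋏ y)`. -/
def wedgeExtension (G : HomLeibnizAlgebra k V) :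
    HomLeibnizAlgebra k (V × (G.TensorSquare ⧸ G.box)) where
  bracket := LinearMap.mk₂ k (fun p q => (G.bracket p.1 q.1, G.wedge p.1 q.1))
    (by intros; simp) (by intros; simp) (by intros; simp) (by intros; simp)
  alpha := G.alpha.prodMap G.exteriorSquare.alpha
  alpha_bracket p q := by simp [G.alpha_bracket, G.exteriorSquare_alpha_wedge]
  hom_leibniz p q r := by
    simp [G.hom_leibniz p.1 q.1 r.1, G.isCocycle_wedge p.1 q.1 r.1]

theorem mem_alphaCenter_wedgeExtension (G : HomLeibnizAlgebra k V)
    (p : V × (G.TensorSquare ⧸ G.box)) :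
    p ∈ G.wedgeExtension.alphaCenter ↔ p.1 ∈ G.exteriorCenter := by
  have hn (n : ℕ) : ((G.wedgeExtension.alpha ^ n) p).1 = (G.alpha ^ n) p.1 :=
    map_alpha_pow (G := G.wedgeExtension) (H := G) (f := LinearMap.fst k _ _) (fun _ => rfl) n p
  have hbr (q r) : G.wedgeExtension.bracket q r = (G.bracket q.1 r.1, G.wedge q.1 r.1) := rfl
  constructor
  · intro h n y
    have := h n (y, 0)
    simp only [hbr, hn, Prod.mk_eq_zero] at this
    exact ⟨this.1.2, this.2.2⟩
  · intro h n q
    simp only [hbr, hn, Prod.mk_eq_zero]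
    obtain ⟨h₁, h₂⟩ := h n q.1
    exact ⟨⟨G.isCocycle_bracket.eq_zero_of_wedge_eq_zero h₁, h₁⟩,
      ⟨G.isCocycle_bracket.eq_zero_of_wedge_eq_zero h₂, h₂⟩⟩

theorem isCapable_of_exteriorCenter_eq_bot {G : HomLeibnizAlgebra k V}
    (h : G.exteriorCenter = ⊥) : IsCapable.{u, v, v} G := by
  let Z := G.wedgeExtension.alphaCenter
  have hZ {p q : V × (G.TensorSquare ⧸ G.box)} (hpq : p.1 = q.1) : Z.mkQ p = Z.mkQ q := by
    refine (Submodule.Quotient.eq _).2 ((G.mem_alphaCenter_wedgeExtension _).2 ?_)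
    rw [Prod.fst_sub, hpq, sub_self]
    exact Submodule.zero_mem _
  have hbij : Function.Bijective (Z.mkQ ∘ₗ LinearMap.inl k V (G.TensorSquare ⧸ G.box)) := by
    constructor
    · refine (injective_iff_map_eq_zero _).2 fun x hx => ?_
      have := (G.mem_alphaCenter_wedgeExtension _).1 ((Submodule.Quotient.mk_eq_zero _).1 hx)
      rw [h] at this
      exact (Submodule.mem_bot k).1 this
    · intro q
      obtain ⟨p, rfl⟩ := Z.mkQ_surjective q
      exact ⟨p.1, hZ rfl⟩
  refine ⟨_, _, _, G.wedgeExtension, ⟨⟨LinearEquiv.ofBijective _ hbij, ?_, ?_⟩⟩⟩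
  · intro x y
    exact hZ (p := (G.bracket x y, 0)) (q := G.wedgeExtension.bracket (x, 0) (y, 0)) rfl
  · intro x
    exact hZ (p := (G.alpha x, 0)) (q := G.wedgeExtension.alpha (x, 0)) rfl

/-- The structure on `W` carried over from `V` along a linear isomorphism. -/
def transport (G : HomLeibnizAlgebra k V) (e : V ≃ₗ[k] W) : HomLeibnizAlgebra k W where
  bracket := (G.bracket.compl₁₂ e.symm.toLinearMap e.symm.toLinearMap).compr₂ e.toLinearMap
  alpha := e.toLinearMap ∘ₗ G.alpha ∘ₗ e.symm.toLinearMap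
  alpha_bracket x y := by simp [G.alpha_bracket]
  hom_leibniz x y z := by simp [G.hom_leibniz]

/-- The tautological isomorphism from a Hom-Leibniz algebra to its transported copy. -/
def isoTransport (G : HomLeibnizAlgebra k V) (e : V ≃ₗ[k] W) : G.Iso (G.transport e) where
  toLinearEquiv := e
  map_bracket x y := by simp [transport]
  map_alpha x := by simp [transport]

theorem IsCapable.of_iso {G : HomLeibnizAlgebra k V} {H : HomLeibnizAlgebra k W} (e : G.Iso H)
    (hH : IsCapable.{u, w, v₁} H) : IsCapable.{u, v, v₁} G := by
  obtain ⟨W', _, _, K, ⟨f⟩⟩ := hH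
  exact ⟨W', _, _, K, ⟨⟨e.toLinearEquiv.trans f.toLinearEquiv,
    fun x y => by simp [e.map_bracket, f.map_bracket],
    fun x => by simp [e.map_alpha, f.map_alpha]⟩⟩⟩

theorem isCapable_of_exteriorCenter_eq_bot_of_small [Small.{w} V] {G : HomLeibnizAlgebra k V}
    (h : G.exteriorCenter = ⊥) : IsCapable.{u, v, w} G := by
  let i := G.isoTransport (Shrink.linearEquiv k V).symm
  refine IsCapable.of_iso i (isCapable_of_exteriorCenter_eq_bot ?_)
  rw [← i.map_exteriorCenter, h, Submodule.map_bot]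

theorem IsCapable.small {G : HomLeibnizAlgebra k V} (hG : IsCapable.{u, v, w} G) :
    Small.{w} V := by
  obtain ⟨W, _, _, K, ⟨e⟩⟩ := hG
  exact small_of_surjective (e.toLinearEquiv.symm.surjective.comp K.alphaCenter.mkQ_surjective)

end Wedge

/-! ### Direct sums -/

section DirectSum

variable {k : Type u} [Field k] {V : Type v} [AddCommGroup V] [Module k V]
  {V₁ : Type v₁} [AddCommGroup V₁] [Module k V₁] {V₂ : Type v₂} [AddCommGroup V₂] [Module k V₂]

/-- If the image of `i` annihilates `z` on both sides, then only one term survives in the cocycle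
relation for the triples `(i x, i y, z)` and `(z, i x, i y)`. -/
theorem wedge_derived_eq_zero {G : HomLeibnizAlgebra k V} {G₁ : HomLeibnizAlgebra k V₁}
    {i : V₁ →ₗ[k] V} (hb : ∀ x y, i (G₁.bracket x y) = G.bracket (i x) (i y)) {z : V}
    (hz : ∀ x, G.bracket (i x) z = 0 ∧ G.bracket z (i x) = 0) {x : V₁} (hx : x ∈ G₁.derived) :
    G.wedge (i x) (G.alpha z) = 0 ∧ G.wedge (G.alpha z) (i x) = 0 := by
  have : G₁.derived ≤ (LinearMap.ker (G.wedge.flip (G.alpha z)) ⊓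
      LinearMap.ker (G.wedge (G.alpha z))).comap i := by
    refine Submodule.span_le.2 ?_
    rintro _ ⟨x, y, rfl⟩
    have h₁ := G.isCocycle_wedge (i x) (i y) z
    have h₂ := G.isCocycle_wedge z (i x) (i y)
    simp only [(hz _).1, (hz _).2, map_zero, LinearMap.zero_apply, sub_zero] at h₁ h₂
    simp [hb, ← h₁, h₂]
  exact this hx

/-- One summand of the inclusion `Z^⋏(G₁) ⊕ Z^⋏(G₂) ≤ Z^⋏(G)`: here `i` and `j` embed the summands
`V₁` and `V₂` in `V`. -/
theorem map_mem_exteriorCenter_of_summand {G : HomLeibnizAlgebra k V}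
    {G₁ : HomLeibnizAlgebra k V₁} {G₂ : HomLeibnizAlgebra k V₂}
    {i : V₁ →ₗ[k] V} {j : V₂ →ₗ[k] V}
    (hi : ∀ x y, i (G₁.bracket x y) = G.bracket (i x) (i y))
    (hiα : ∀ x, i (G₁.alpha x) = G.alpha (i x)) (hjα : ∀ x, j (G₂.alpha x) = G.alpha (j x))
    (hij : ∀ x y, G.bracket (i x) (j y) = 0 ∧ G.bracket (j y) (i x) = 0)
    (hsum : ∀ v, ∃ x y, v = i x + j y) (hα : Function.Surjective G₂.alpha)
    {x : V₁} (hx : x ∈ G₁.exteriorCenter) : i x ∈ G.exteriorCenter := by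
  intro n v
  obtain ⟨y, z, rfl⟩ := hsum v
  obtain ⟨z, rfl⟩ := hα z
  have hmem : (G₁.alpha ^ n) x ∈ G₁.derived := by
    refine G₁.exteriorCenter_le_derived fun m y => ?_
    rw [← Module.End.mul_apply, ← pow_add]
    exact hx (m + n) y
  obtain ⟨h₁, h₂⟩ := wedge_derived_eq_zero hi (fun x => hij x z) hmem
  rw [← map_alpha_pow hiα, hjα, map_add, map_add, LinearMap.add_apply, h₁, h₂,
    map_wedge_eq_zero hi hiα (hx n y).1, map_wedge_eq_zero hi hiα (hx n y).2, add_zero]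
  exact ⟨rfl, rfl⟩

theorem exteriorCenter_directSum (G₁ : HomLeibnizAlgebra k V₁) (G₂ : HomLeibnizAlgebra k V₂)
    (h₁ : Function.Surjective G₁.alpha) (h₂ : Function.Surjective G₂.alpha) :
    (G₁.directSum G₂).exteriorCenter = G₁.exteriorCenter.prod G₂.exteriorCenter := by
  apply le_antisymm
  · intro x hx
    refine Submodule.mem_prod.2 ⟨?_, ?_⟩
    · exact map_mem_exteriorCenter (G := G₁.directSum G₂) (f := LinearMap.fst k V₁ V₂)
        (fun _ _ => rfl) (fun _ => rfl) LinearMap.fst_surjective hx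
    · exact map_mem_exteriorCenter (G := G₁.directSum G₂) (f := LinearMap.snd k V₁ V₂)
        (fun _ _ => rfl) (fun _ => rfl) LinearMap.snd_surjective hx
  · rintro ⟨x, y⟩ ⟨hx, hy⟩
    have hx' : LinearMap.inl k V₁ V₂ x ∈ (G₁.directSum G₂).exteriorCenter :=
      map_mem_exteriorCenter_of_summand (j := LinearMap.inr k V₁ V₂)
        (by simp [directSum]) (by simp [directSum]) (by simp [directSum]) (by simp [directSum])
        (fun v => ⟨v.1, v.2, by simp⟩) h₂ hx
    have hy' : LinearMap.inr k V₁ V₂ y ∈ (G₁.directSum G₂).exteriorCenter :=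
      map_mem_exteriorCenter_of_summand (j := LinearMap.inl k V₁ V₂)
        (by simp [directSum]) (by simp [directSum]) (by simp [directSum]) (by simp [directSum])
        (fun v => ⟨v.2, v.1, by simp⟩) h₁ hy
    simpa using Submodule.add_mem _ hx' hy'

end DirectSum

end HomLeibnizAlgebra

open HomLeibnizAlgebra in
theorem theorem5p10 {k : Type u} [Field k]
    {V : Type v} [AddCommGroup V] [Module k V] [FiniteDimensional k V]
    {V₁ : Type v₁} [AddCommGroup V₁] [Module k V₁]
    {V₂ : Type v₂} [AddCommGroup V₂] [Module k V₂]
    (G : HomLeibnizAlgebra k V) (G₁ : HomLeibnizAlgebra k V₁) (G₂ : HomLeibnizAlgebra k V₂)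
    (hG : G.IsRegular) (e : G.Iso (G₁.directSum G₂)) :
    (HomLeibnizAlgebra.IsCapable.{u, v, w} G →
      HomLeibnizAlgebra.IsCapable.{u, v₁, w} G₁ ∧ HomLeibnizAlgebra.IsCapable.{u, v₂, w} G₂) ∧
    G.exteriorCenter.map (e.toLinearEquiv : V →ₗ[k] V₁ × V₂) =
      G₁.exteriorCenter.prod G₂.exteriorCenter := by
  have hsurj : Function.Surjective (G₁.directSum G₂).alpha := by
    intro y
    obtain ⟨x, hx⟩ := hG.2 (e.toLinearEquiv.symm y)
    exact ⟨e.toLinearEquiv x, by rw [← e.map_alpha, hx, LinearEquiv.apply_symm_apply]⟩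
  have h₁ : Function.Surjective G₁.alpha := fun y =>
    (hsurj (y, 0)).imp' Prod.fst fun _ h => congrArg Prod.fst h
  have h₂ : Function.Surjective G₂.alpha := fun y =>
    (hsurj (0, y)).imp' Prod.snd fun _ h => congrArg Prod.snd h
  have hmap : G.exteriorCenter.map (e.toLinearEquiv : V →ₗ[k] V₁ × V₂) =
      G₁.exteriorCenter.prod G₂.exteriorCenter := by
    rw [e.map_exteriorCenter, exteriorCenter_directSum G₁ G₂ h₁ h₂]
  refine ⟨fun hcap => ?_, hmap⟩
  have : Small.{w} V := hcap.small
  have : Small.{w} V₁ :=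
    small_of_surjective (Prod.fst_surjective.comp e.toLinearEquiv.surjective)
  have : Small.{w} V₂ :=
    small_of_surjective (Prod.snd_surjective.comp e.toLinearEquiv.surjective)
  rw [exteriorCenter_eq_bot_of_isCapable hcap, Submodule.map_bot, eq_comm,
    Submodule.prod_eq_bot_iff] at hmap
  exact ⟨isCapable_of_exteriorCenter_eq_bot_of_small hmap.1,
    isCapable_of_exteriorCenter_eq_bot_of_small hmap.2⟩
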